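/- Let $1\le a\le b<N$ be integers and $\mathcal N=\{1,\dots,N\}$. For every horizon $T\ge 1$ consider the following repeated game with rounds $t=1,\dots,T$. In round $t$ the number $M_t\in\{a,\dots,b\}$ is revealed to the defender (it is random and may depend on the past in any way). Then, given the past and $M_t$, the attacker and the defender choose independently of each other a location $I_t\in\mathcal N$ and a set $J_t\subset\mathcal N$ with $|J_t|=M_t$. Put $y_k(t)=1$ if $k=I_t$ and $y_k(t)=0$ otherwise, and $x_k(t)=1$ if $k\notin J_t$ and $x_k(t)=0$ otherwise. The attacker receives $x_{I_t}(t)$ and the defender receives $s(t)=\sum_{j\in J_t}y_j(t)$. *Defender.* The defender uses Exp3.M-VP with parameter $$\eta=\eta_T=\min\left\{1,\sqrt{\frac{N a\ln(N/b)}{(a+(e-2)b)\,b\,T}}\right\}.$$ That is: $w_i(1)=1$ for all $i$. In round $t$, if $(1-\eta)\max_j w_j(t)\ge \left(\frac1{M_t}-\frac{\eta}{N}\right)\sum_i w_i(t)$, let $\kappa_t>0$ be the solution of $$\frac{\kappa_t}{\sum_{w_i(t)\ge\kappa_t}\kappa_t+\sum_{w_i(t)<\kappa_t}w_i(t)}=\frac{\frac1{M_t}-\frac{\eta}{N}}{1-\eta},$$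 let $S_0(t)=\{i: w_i(t)\ge\kappa_t\}$ and $w_i'(t)=\kappa_t$ for $i\in S_0(t)$; otherwise let $S_0(t)=\emptyset$. Let $w'_i(t)=w_i(t)$ for $i\notin S_0(t)$ and $$\hat\alpha_i(t)=M_t\left((1-\eta)\frac{w_i'(t)}{\sum_j w_j'(t)}+\frac{\eta}{N}\right).$$ The set $J_t$ is drawn by dependent rounding (DepRound) of the vector $p=\hat\alpha(t)$: while some coordinate of $p$ lies in $(0,1)$, choose (in any way) distinct $i,j$ with $p_i,p_j\in(0,1)$, let $\rho=\min\{1-p_i,p_j\}$, $\zeta=\min\{p_i,1-p_j\}$, and replace $(p_i,p_j)$ by $(p_i+\rho,p_j-\rho)$ with probability $\frac{\zeta}{\rho+\zeta}$ and by $(p_i-\zeta,p_j+\zeta)$ with probability $\frac{\rho}{\rho+\zeta}$; finally return $J_t=\{k:p_k=1\}$. Let $\hat y_i(t)=y_i(t)/\hat\alpha_i(t)$ for $i\in J_t$ and $\hat y_i(t)=0$ otherwise; then $w_i(t+1)=w_i(t)\exp(M_t\,\eta\,\hat y_i(t)/N)$ for $i\notin S_0(t)$ and $w_i(t+1)=w_i(t)$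 for $i\in S_0(t)$. *Attacker.* The attacker uses any no-regret algorithm: for each horizon $T$ a randomized policy that draws $I_t$ from a law depending only on the attacker's own past choices and rewards, such that for some $R(T)=o(T)$, against every (possibly randomized and adaptive) opponent producing $x_k(t)\in\{0,1\}$ (where $x(t)$ may depend on the past, and $I_t$ and $x(t)$ are independent given the past), the pseudo-regret satisfies $$\max_{k\in\mathcal N}\mathbb E\left[\sum_{t=1}^T x_k(t)\right]-\mathbb E\left[\sum_{t=1}^T x_{I_t}(t)\right]\le R(T)\qquad\text{for all }T.$$ Suppose that $M_t$ is a wide-sense stationary process with mean $\nu$ (for each horizon $T$, on the rounds $1,\dots,T$: $\mathbb E[M_t]=\nu$ for all $t$, and $\mathrm{Cov}(M_t,M_{t+h})$ depends only on $h$). Then the defender's infinite-horizon average reward equals $\nu/N$: $$\bar s_\infty:=\liminf_{T\to\infty}\mathbb E\left[\frac1T\sum_{t=1}^{T}s(t)\right]=\frac{\nu}{N},$$ where the expectation for the horizon $T$ is taken in the game of horizon $T$ with $\eta=\eta_T$. -/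

import Mathlib

open MeasureTheory ProbabilityTheory Filter Topology

universe u

/-! ### The pursuit-evasion game

There are `N` locations. Rounds are numbered `t = 0, 1, 2, …` and a game of horizon `T` consists of
the rounds `t < T`. -/

/-- What happens in one round: the number `M_t` of locations the defender may scan, the location
`I_t` compromised by the attacker, and the set `J_t` of locations scanned by the defender. -/
structure Round (N : ℕ) where
  plays : ℕ
  attacked : Fin N
  scanned : Finset (Fin N)

/-- The attacker's reward for location `k` when the set `S` is scanned: `x_k = 1` if the defender
does not search `k`, and `x_k = 0` otherwise. -/
noncomputable def evasion {N : ℕ} (S : Finset (Fin N)) (k : Fin N) : ℝ :=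
  if k ∈ S then 0 else 1

/-- `y_k = 1` if the attacker compromises location `k`, and `y_k = 0` otherwise. -/
noncomputable def Round.attack {N : ℕ} (r : Round N) (k : Fin N) : ℝ :=
  if k = r.attacked then 1 else 0

/-- The defender's reward `s = ∑_{j ∈ J} y_j` in one round. -/
noncomputable def Round.defenderReward {N : ℕ} (r : Round N) : ℝ :=
  ∑ j ∈ r.scanned, r.attack j

/-! ### The defender: DepRound and Exp3.M-VP -/

/-- `p` with `p_i` increased by `c` and `p_j` decreased by `c`. -/
noncomputable def transfer {N : ℕ} (p : Fin N → ℝ) (i j : Fin N) (c : ℝ) : Fin N → ℝ :=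
  Function.update (Function.update p i (p i + c)) j (p j - c)

/-- `DepRoundLaw p Q`: the random output of a run of the dependent rounding procedure started at `p`
can have law `Q`. As long as some coordinate lies strictly between `0` and `1`, the procedure chooses
two distinct such coordinates `i`, `j`, in any way (possibly at random, constructor `mix`), and with
`ρ = min (1 - p_i) p_j`, `ζ = min p_i (1 - p_j)` replaces `(p_i, p_j)` by `(p_i + ρ, p_j - ρ)` with
probability `ζ / (ρ + ζ)` and by `(p_i - ζ, p_j + ζ)` with probability `ρ / (ρ + ζ)`. When no such
coordinate is left, it returns `{k | p_k = 1}`. -/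
inductive DepRoundLaw {N : ℕ} : (Fin N → ℝ) → PMF (Finset (Fin N)) → Prop
  | done (p : Fin N → ℝ) (S : Finset (Fin N)) (hp : ∀ k, ¬ (0 < p k ∧ p k < 1))
      (hS : ∀ k, k ∈ S ↔ p k = 1) : DepRoundLaw p (PMF.pure S)
  | step (p : Fin N → ℝ) (i j : Fin N) (hij : i ≠ j)
      (hi : 0 < p i ∧ p i < 1) (hj : 0 < p j ∧ p j < 1)
      (ρ ζ : ℝ) (hρ : ρ = min (1 - p i) (p j)) (hζ : ζ = min (p i) (1 - p j))
      (Q₁ Q₂ Q : PMF (Finset (Fin N)))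
      (h₁ : DepRoundLaw (transfer p i j ρ) Q₁) (h₂ : DepRoundLaw (transfer p i j (-ζ)) Q₂)
      (hQ : ∀ S, (Q S).toReal =
        ζ / (ρ + ζ) * (Q₁ S).toReal + ρ / (ρ + ζ) * (Q₂ S).toReal) : DepRoundLaw p Q
  | mix (p : Fin N → ℝ) (c : ℝ) (hc : 0 ≤ c ∧ c ≤ 1) (Q₁ Q₂ Q : PMF (Finset (Fin N)))
      (h₁ : DepRoundLaw p Q₁) (h₂ : DepRoundLaw p Q₂)
      (hQ : ∀ S, (Q S).toReal = c * (Q₁ S).toReal + (1 - c) * (Q₂ S).toReal) : DepRoundLaw p Q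

/-- `D` is an implementation of dependent rounding: on every vector of marginals in `[0,1]^N` with an
integer sum, `D p` is the law of the output of a run started at `p`. -/
def IsDepRound {N : ℕ} (D : (Fin N → ℝ) → PMF (Finset (Fin N))) : Prop :=
  ∀ (p : Fin N → ℝ) (m : ℕ), (∀ k, 0 ≤ p k ∧ p k ≤ 1) → ∑ k, p k = m → DepRoundLaw p (D p)

/-- The test `max_j w_j ≥ (1/m - η/N) ∑_i w_i / (1 - η)`, with the denominator cleared (for `η = 1`
the right-hand side is `+∞`). -/
def NeedsCap {N : ℕ} (η : ℝ) (m : ℕ) (w : Fin N → ℝ) : Prop :=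
  ∃ j, (1 / (m : ℝ) - η / N) * ∑ i, w i ≤ (1 - η) * w j

open Classical in
/-- The equation that determines the threshold `κ > 0`. -/
def IsCap {N : ℕ} (η : ℝ) (m : ℕ) (w : Fin N → ℝ) (κ : ℝ) : Prop :=
  0 < κ ∧
    κ / (∑ i with κ ≤ w i, κ + ∑ i with w i < κ, w i) = (1 / (m : ℝ) - η / N) / (1 - η)

/-- The threshold `κ`; whenever `1 ≤ m < N`, `0 < η < 1`, `w > 0` and the test `NeedsCap` succeeds,
the equation has exactly one solution. -/
noncomputable def cap {N : ℕ} (η : ℝ) (m : ℕ) (w : Fin N → ℝ) : ℝ :=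
  Classical.epsilon (IsCap η m w)

open Classical in
/-- The set `S₀` of locations whose weights are capped. -/
noncomputable def cappedSet {N : ℕ} (η : ℝ) (m : ℕ) (w : Fin N → ℝ) : Finset (Fin N) :=
  if NeedsCap η m w then Finset.univ.filter (fun i => cap η m w ≤ w i) else ∅

/-- The modified weights `w'`. -/
noncomputable def cappedWeight {N : ℕ} (η : ℝ) (m : ℕ) (w : Fin N → ℝ) (i : Fin N) : ℝ :=
  if i ∈ cappedSet η m w then cap η m w else w i

/-- The marginal scanning probabilities `α̂_i = m ((1 - η) w'_i / ∑_j w'_j + η / N)`. -/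
noncomputable def marginal {N : ℕ} (η : ℝ) (m : ℕ) (w : Fin N → ℝ) (i : Fin N) : ℝ :=
  m * ((1 - η) * (cappedWeight η m w i / ∑ j, cappedWeight η m w j) + η / N)

/-- The importance-weighted estimate `ŷ_i` of the reward of location `i` after the round `r`, when
the weights at the beginning of the round are `w`. -/
noncomputable def rewardEstimate {N : ℕ} (η : ℝ) (w : Fin N → ℝ) (r : Round N) (i : Fin N) : ℝ :=
  if i ∈ r.scanned then r.attack i / marginal η r.plays w i else 0

/-- The weights of Exp3.M-VP with parameter `η` at the beginning of round `t`, along the sequence of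
rounds `r` (they depend only on the rounds before `t`). -/
noncomputable def exp3Weight {N : ℕ} (η : ℝ) (r : ℕ → Round N) : ℕ → Fin N → ℝ
  | 0 => fun _ => 1
  | t + 1 => fun i =>
      if i ∈ cappedSet η (r t).plays (exp3Weight η r t) then exp3Weight η r t i
      else exp3Weight η r t i *
        Real.exp ((r t).plays * η * rewardEstimate η (exp3Weight η r t) (r t) i / N)

/-- The law of the set `J_t` scanned by Exp3.M-VP with parameter `η` in round `t`, given the rounds
before `t` and `M_t`. -/
noncomputable def exp3MVP {N : ℕ} (D : (Fin N → ℝ) → PMF (Finset (Fin N))) (η : ℝ)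
    (r : ℕ → Round N) (t : ℕ) : PMF (Finset (Fin N)) :=
  D (marginal η (r t).plays (exp3Weight η r t))

/-- The tuned parameter `η = min {1, √(N a ln(N/b) / ((a + (e-2) b) b T))}`. -/
noncomputable def tunedEta (N a b T : ℕ) : ℝ :=
  min 1 (Real.sqrt ((N : ℝ) * a * Real.log ((N : ℝ) / b) /
    (((a : ℝ) + (Real.exp 1 - 2) * b) * b * T)))

/-! ### The attacker -/

/-- A randomized policy of the attacker: in round `t` the law of the chosen location depends on the
locations chosen and the rewards received in the previous rounds. -/
abbrev AttackerPolicy (N : ℕ) := (t : ℕ) → (Fin t → Fin N × ℝ) → PMF (Fin N)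

/-- The choices `I` follow the policy `π` during the first `T` rounds against an opponent scanning
the sets `C`: given the past and `C_t`, the location `I_t` is drawn from `π` applied to the
attacker's own past choices and rewards. The set `C_t` may depend on the past in any way. -/
def FollowsPolicy {N : ℕ} {Ω : Type*} [MeasurableSpace Ω] (P : Measure Ω) (T : ℕ)
    (π : AttackerPolicy N) (I : ℕ → Ω → Fin N) (C : ℕ → Ω → Finset (Fin N)) : Prop :=
  ∀ t < T, ∀ (i : ℕ → Fin N) (c : ℕ → Finset (Fin N)),
    P {ω | ∀ s ≤ t, I s ω = i s ∧ C s ω = c s} =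
      P {ω | (∀ s < t, I s ω = i s ∧ C s ω = c s) ∧ C t ω = c t} *
        π t (fun s => (i s, evasion (c s) (i s))) (i t)

/-- The algorithm that uses the policy `π T` for the horizon `T` is a no-regret algorithm: against
every (possibly randomized and adaptive) opponent, the pseudo-regret
`max_k E[∑_{t<T} x_k(t)] - E[∑_{t<T} x_{I_t}(t)]` is at most a bound `R T = o(T)`. -/
def NoRegret {N : ℕ} (π : ℕ → AttackerPolicy N) : Prop :=
  ∃ R : ℕ → ℝ, Tendsto (fun T : ℕ => R T / T) atTop (𝓝 0) ∧
    ∀ (T : ℕ) (Ω : Type u) [MeasurableSpace Ω] (P : Measure Ω) [IsProbabilityMeasure P]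
      (I : ℕ → Ω → Fin N) (C : ℕ → Ω → Finset (Fin N)),
      (∀ t, Measurable (I t)) → (∀ t, Measurable[_, ⊤] (C t)) →
      FollowsPolicy P T (π T) I C →
      ∀ k : Fin N, ∫ ω, ∑ t ∈ Finset.range T, evasion (C t ω) k ∂P -
        ∫ ω, ∑ t ∈ Finset.range T, evasion (C t ω) (I t ω) ∂P ≤ R T

/-! ### The game of horizon `T` -/

/-- `X` is the random sequence of rounds of the game of horizon `T`, where `a ≤ M_t ≤ b`, the
defender uses Exp3.M-VP with parameter `η` and the attacker uses the policy `π`. Given the past, the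
number `M_t` is arbitrary; given the past and `M_t`, the two players choose `I_t` and `J_t`
independently of each other. -/
structure IsGame {N : ℕ} {Ω : Type*} [MeasurableSpace Ω] (P : Measure Ω) (X : ℕ → Ω → Round N)
    (T a b : ℕ) (D : (Fin N → ℝ) → PMF (Finset (Fin N))) (η : ℝ) (π : AttackerPolicy N) :
    Prop where
  measurable : ∀ t, Measurable[_, ⊤] (X t)
  plays_mem : ∀ t < T, ∀ ω, a ≤ (X t ω).plays ∧ (X t ω).plays ≤ b
  law : ∀ t < T, ∀ r : ℕ → Round N,
    P {ω | ∀ s ≤ t, X s ω = r s} =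
      P {ω | (∀ s < t, X s ω = r s) ∧ (X t ω).plays = (r t).plays} *
        (π t (fun s => ((r s).attacked, evasion (r s).scanned (r s).attacked)) (r t).attacked *
          exp3MVP D η r t (r t).scanned)

/-- The real process `Y`, observed at the times in `A`, is wide-sense stationary with mean `ν`: it is
square-integrable, has constant mean `ν`, and its autocovariance depends only on the lag. -/
structure IsWideSenseStationary {Ω : Type*} [MeasurableSpace Ω] (P : Measure Ω) (A : Set ℕ)
    (Y : ℕ → Ω → ℝ) (ν : ℝ) : Prop where
  memLp : ∀ t ∈ A, MemLp (Y t) 2 P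
  mean : ∀ t ∈ A, ∫ ω, Y t ω ∂P = ν
  autocov : ∀ s t h : ℕ, s ∈ A → t ∈ A → s + h ∈ A → t + h ∈ A →
    cov[Y s, Y (s + h); P] = cov[Y t, Y (t + h); P]

/-!
Both players can secure the value `ν / N` up to a vanishing error, so the average reward even
converges to it.

*Upper bound* (`IsGame.integral_reward_le`). The defender and the source of the numbers `M_t`
together form one adaptive opponent of the attacker (`IsGame.followsPolicy`), so the attacker's
regret bound applies. The average over `k` of the rewards for staying at `k` is `1 - |J_t| / N` in
round `t`, and `E |J_t| = E M_t = ν` because dependent rounding has the prescribed marginals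
(`DepRoundLaw.sum_mem`), whose sum is `M_t`.

*Lower bound* (`IsGame.le_integral_reward`). This bound holds against every attacker. Consider the
potential `log (∑ w_i) - (1 / N) ∑ log w_i`, which is nonnegative and starts at `log N`. In a
round where the attacked location `I` is scanned and not capped, the first term increases by at
most `η / (N (1 - η)) · (1 + M_t η / (N α̂_I))`, and the second decreases the potential by
`M_t η / (N² α̂_I)` (`potential_exp3Weight_succ_le`). Since `I` is scanned with conditional probability
`α̂_I` given the past, `M_t` and `I` (`IsGame.integral_indicator_attacked_mem`), the factors
`1 / α̂_I` disappear in expectation, and summation over the rounds yields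
`(1 - η) ν T / N ≤ E ∑ s(t) + (1 - η) N log N / η + b η T / N`. For the tuned parameter, `η → 0` and `η T → ∞`, so the error
terms are `o(T)`. As `η < 1` for long horizons, the degenerate case `η = 1` of the algorithm never
has to be considered.
-/

/-! ### Dependent rounding -/

theorem transfer_of_ne {N : ℕ} (p : Fin N → ℝ) {i j k : Fin N} (c : ℝ) (hi : k ≠ i) (hj : k ≠ j) :
    transfer p i j c k = p k := by
  simp [transfer, hi, hj]

theorem transfer_left {N : ℕ} (p : Fin N → ℝ) {i j : Fin N} (c : ℝ) (hij : i ≠ j) :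
    transfer p i j c i = p i + c := by
  simp [transfer, hij]

theorem transfer_right {N : ℕ} (p : Fin N → ℝ) (i j : Fin N) (c : ℝ) :
    transfer p i j c j = p j - c := by
  simp [transfer]

theorem transfer_mem_unitInterval {N : ℕ} {p : Fin N → ℝ} {i j : Fin N} {c : ℝ} (hij : i ≠ j)
    (hp : ∀ k, 0 ≤ p k ∧ p k ≤ 1) (hi : 0 ≤ p i + c ∧ p i + c ≤ 1)
    (hj : 0 ≤ p j - c ∧ p j - c ≤ 1) (k : Fin N) :
    0 ≤ transfer p i j c k ∧ transfer p i j c k ≤ 1 := by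
  rcases eq_or_ne k j with rfl | hkj
  · rwa [transfer_right]
  rcases eq_or_ne k i with rfl | hki
  · rwa [transfer_left p c hij]
  · rw [transfer_of_ne p c hki hkj]; exact hp k

/-- Dependent rounding preserves marginals: each of its steps is a martingale step in every
coordinate. -/
theorem DepRoundLaw.sum_mem {N : ℕ} {p : Fin N → ℝ} {Q : PMF (Finset (Fin N))}
    (h : DepRoundLaw p Q) (hp : ∀ k, 0 ≤ p k ∧ p k ≤ 1) (k : Fin N) :
    ∑ S with k ∈ S, (Q S).toReal = p k := by
  induction h with
  | done p S hp' hS =>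
    have h1 : ∀ S' : Finset (Fin N), ((PMF.pure S) S').toReal = if S' = S then 1 else 0 := by
      intro S'
      rw [PMF.pure_apply]
      split_ifs <;> simp
    simp only [h1, Finset.sum_ite_eq', Finset.mem_filter, Finset.mem_univ, true_and, hS]
    split_ifs with h2
    · exact h2.symm
    · by_contra h3
      exact hp' k ⟨lt_of_le_of_ne (hp k).1 h3, lt_of_le_of_ne (hp k).2 h2⟩
  | step p i j hij hi hj ρ ζ hρ hζ Q₁ Q₂ Q h₁ h₂ hQ ih₁ ih₂ =>
    have hρ0 : 0 < ρ := by rw [hρ]; exact lt_min (by linarith [hi.2]) hj.1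
    have hζ0 : 0 < ζ := by rw [hζ]; exact lt_min hi.1 (by linarith [hj.2])
    have hρ1 : ρ ≤ 1 - p i := hρ ▸ min_le_left _ _
    have hρ2 : ρ ≤ p j := hρ ▸ min_le_right _ _
    have hζ1 : ζ ≤ p i := hζ ▸ min_le_left _ _
    have hζ2 : ζ ≤ 1 - p j := hζ ▸ min_le_right _ _
    simp only [hQ, Finset.sum_add_distrib, ← Finset.mul_sum]
    rw [ih₁ (transfer_mem_unitInterval hij hp ⟨by linarith, by linarith⟩
        ⟨by linarith, by linarith⟩),
      ih₂ (transfer_mem_unitInterval hij hp ⟨by linarith, by linarith⟩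
        ⟨by linarith, by linarith⟩)]
    have h0 : ρ + ζ ≠ 0 := by positivity
    rcases eq_or_ne k j with rfl | hkj
    · rw [transfer_right, transfer_right]; field_simp; ring
    rcases eq_or_ne k i with rfl | hki
    · rw [transfer_left p _ hij, transfer_left p _ hij]; field_simp; ring
    · rw [transfer_of_ne p _ hki hkj, transfer_of_ne p _ hki hkj]; field_simp; ring
  | mix p c hc Q₁ Q₂ Q h₁ h₂ hQ ih₁ ih₂ =>
    simp only [hQ, Finset.sum_add_distrib, ← Finset.mul_sum]
    rw [ih₁ hp, ih₂ hp]
    ring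

/-! ### The marginal scanning probabilities of Exp3.M-VP -/

section Marginal

variable {N : ℕ} {η : ℝ} {m : ℕ} {w : Fin N → ℝ}

open Classical in
/-- The denominator in the equation for the threshold is the sum of the truncated weights. -/
theorem sum_cap_add_sum_lt (w : Fin N → ℝ) (κ : ℝ) :
    ∑ i with κ ≤ w i, κ + ∑ i with w i < κ, w i = ∑ i, min κ (w i) := by
  rw [← Finset.sum_filter_add_sum_filter_not Finset.univ (fun i => κ ≤ w i)
    (fun i => min κ (w i))]
  congr 1
  · refine Finset.sum_congr rfl fun i hi => ?_
    rw [min_eq_left (Finset.mem_filter.1 hi).2]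
  · simp only [not_le]
    refine Finset.sum_congr rfl fun i hi => ?_
    rw [min_eq_right (Finset.mem_filter.1 hi).2.le]

theorem isCap_iff {κ : ℝ} : IsCap η m w κ ↔
    0 < κ ∧ κ / ∑ i, min κ (w i) = (1 / (m : ℝ) - η / N) / (1 - η) := by
  rw [IsCap, sum_cap_add_sum_lt]

/-- The threshold exists: the ratio `κ / ∑ i, min κ (w i)` is continuous in `κ`, equals `1 / N` at
the smallest weight, and exceeds the target at the largest weight when the test succeeds. -/
theorem exists_isCap (hη1 : η < 1) (hm : 1 ≤ m) (hmN : m < N)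
    (hw : ∀ i, 0 < w i) (h : NeedsCap η m w) : ∃ κ, IsCap η m w κ := by
  obtain ⟨j, hj⟩ := h
  have hm0 : (0 : ℝ) < m := by exact_mod_cast hm
  have hmN' : (m : ℝ) < N := by exact_mod_cast hmN
  have hN0 : (0 : ℝ) < N := hm0.trans hmN'
  have h1η : 0 < 1 - η := by linarith
  obtain ⟨i₀, -, hi₀⟩ := Finset.exists_min_image Finset.univ w ⟨j, Finset.mem_univ j⟩
  obtain ⟨i₁, -, hi₁⟩ := Finset.exists_max_image Finset.univ w ⟨j, Finset.mem_univ j⟩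
  have hpos : ∀ κ, 0 < κ → 0 < ∑ i, min κ (w i) := fun κ hκ =>
    Finset.sum_pos (fun i _ => lt_min hκ (hw i)) ⟨j, Finset.mem_univ j⟩
  have hcont : ContinuousOn (fun κ => κ / ∑ i, min κ (w i)) (Set.Icc (w i₀) (w i₁)) := by
    refine ContinuousOn.div continuousOn_id (by fun_prop) fun κ hκ => ?_
    exact (hpos κ ((hw i₀).trans_le hκ.1)).ne'
  have hlow : w i₀ / ∑ i, min (w i₀) (w i) ≤ (1 / (m : ℝ) - η / N) / (1 - η) := by
    have : ∑ i, min (w i₀) (w i) = N * w i₀ := by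
      rw [Finset.sum_congr rfl fun i hi => min_eq_left (hi₀ i hi)]
      simp
    rw [this, le_div_iff₀ h1η]
    have h2 : w i₀ / (N * w i₀) = 1 / N := by
      have := (hw i₀).ne'
      field_simp
    have h3 : 1 / (N : ℝ) ≤ 1 / m := one_div_le_one_div_of_le hm0 hmN'.le
    rw [h2]
    calc 1 / (N : ℝ) * (1 - η) = 1 / N - η / N := by ring
      _ ≤ _ := by linarith
  have hhigh : (1 / (m : ℝ) - η / N) / (1 - η) ≤ w i₁ / ∑ i, min (w i₁) (w i) := by
    rw [Finset.sum_congr rfl fun i hi => min_eq_right (hi₁ i hi),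
      div_le_div_iff₀ h1η (Finset.sum_pos (fun i _ => hw i) ⟨j, Finset.mem_univ j⟩)]
    have := mul_le_mul_of_nonneg_left (hi₁ j (Finset.mem_univ j)) h1η.le
    linarith
  obtain ⟨κ, hκ, hκ'⟩ := intermediate_value_Icc (hi₀ i₁ (Finset.mem_univ _)) hcont ⟨hlow, hhigh⟩
  exact ⟨κ, isCap_iff.2 ⟨(hw i₀).trans_le hκ.1, hκ'⟩⟩

theorem isCap_cap (hη1 : η < 1) (hm : 1 ≤ m) (hmN : m < N)
    (hw : ∀ i, 0 < w i) (h : NeedsCap η m w) : IsCap η m w (cap η m w) :=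
  Classical.epsilon_spec (exists_isCap hη1 hm hmN hw h)

theorem cappedWeight_of_needsCap (h : NeedsCap η m w) (i : Fin N) :
    cappedWeight η m w i = min (cap η m w) (w i) := by
  rw [cappedWeight, cappedSet, if_pos h]
  by_cases hi : cap η m w ≤ w i
  · simp [hi]
  · simp [hi, (not_le.1 hi).le]

theorem cappedWeight_of_not_needsCap (h : ¬ NeedsCap η m w) (i : Fin N) :
    cappedWeight η m w i = w i := by
  simp [cappedWeight, cappedSet, h]

theorem cappedWeight_le (i : Fin N) : cappedWeight η m w i ≤ w i := by
  by_cases h : NeedsCap η m w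
  · rw [cappedWeight_of_needsCap h]; exact min_le_right _ _
  · rw [cappedWeight_of_not_needsCap h]

theorem cappedWeight_pos (hη1 : η < 1) (hm : 1 ≤ m) (hmN : m < N)
    (hw : ∀ i, 0 < w i) (i : Fin N) : 0 < cappedWeight η m w i := by
  by_cases h : NeedsCap η m w
  · rw [cappedWeight_of_needsCap h]
    exact lt_min (isCap_cap hη1 hm hmN hw h).1 (hw i)
  · rw [cappedWeight_of_not_needsCap h]; exact hw i

theorem sum_cappedWeight_pos (hη1 : η < 1) (hm : 1 ≤ m) (hmN : m < N)
    (hw : ∀ i, 0 < w i) : 0 < ∑ i, cappedWeight η m w i :=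
  Finset.sum_pos (fun i _ => cappedWeight_pos hη1 hm hmN hw i)
    ⟨⟨0, by omega⟩, Finset.mem_univ _⟩

theorem sum_marginal (hη1 : η < 1) (hm : 1 ≤ m) (hmN : m < N)
    (hw : ∀ i, 0 < w i) : ∑ i, marginal η m w i = m := by
  have hN0 : (N : ℝ) ≠ 0 := by
    have : N ≠ 0 := by omega
    exact_mod_cast this
  simp only [marginal]
  rw [← Finset.mul_sum, Finset.sum_add_distrib, ← Finset.mul_sum, ← Finset.sum_div,
    div_self (sum_cappedWeight_pos hη1 hm hmN hw).ne']
  simp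
  field_simp
  simp

theorem le_marginal (hη1 : η < 1) (hm : 1 ≤ m) (hmN : m < N)
    (hw : ∀ i, 0 < w i) (i : Fin N) : m * (η / N) ≤ marginal η m w i := by
  unfold marginal
  have h1 := (cappedWeight_pos hη1 hm hmN hw i).le
  have h2 := (sum_cappedWeight_pos hη1 hm hmN hw).le
  have h3 : 0 ≤ (1 - η) * (cappedWeight η m w i / ∑ j, cappedWeight η m w j) :=
    mul_nonneg (by linarith) (div_nonneg h1 h2)
  gcongr
  linarith

theorem marginal_pos (hη0 : 0 < η) (hη1 : η < 1) (hm : 1 ≤ m) (hmN : m < N)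
    (hw : ∀ i, 0 < w i) (i : Fin N) : 0 < marginal η m w i := by
  refine lt_of_lt_of_le ?_ (le_marginal hη1 hm hmN hw i)
  have : (0 : ℝ) < m := by exact_mod_cast hm
  have : (0 : ℝ) < N := by exact_mod_cast (by omega : 0 < N)
  positivity

/-- The threshold is chosen so that a weight equal to it receives the scanning probability `1`. -/
theorem mul_cap_div_add (hη1 : η < 1) (hm : 1 ≤ m) (hmN : m < N)
    (hw : ∀ i, 0 < w i) (h : NeedsCap η m w) :
    m * ((1 - η) * (cap η m w / ∑ j, cappedWeight η m w j) + η / N) = 1 := by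
  have h1 := (isCap_iff.1 (isCap_cap hη1 hm hmN hw h)).2
  have hm0 : (m : ℝ) ≠ 0 := by exact_mod_cast (by omega : m ≠ 0)
  have h1η : 1 - η ≠ 0 := by linarith
  simp only [cappedWeight_of_needsCap h]
  rw [h1, mul_div_cancel₀ _ h1η]
  field_simp
  ring

theorem marginal_eq_one (hη1 : η < 1) (hm : 1 ≤ m) (hmN : m < N)
    (hw : ∀ i, 0 < w i) {i : Fin N} (hi : i ∈ cappedSet η m w) : marginal η m w i = 1 := by
  have h : NeedsCap η m w := by
    by_contra h
    simp [cappedSet, h] at hi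
  rw [← mul_cap_div_add hη1 hm hmN hw h, marginal]
  simp [cappedWeight, hi]

theorem marginal_le_one (hη1 : η < 1) (hm : 1 ≤ m) (hmN : m < N)
    (hw : ∀ i, 0 < w i) (i : Fin N) : marginal η m w i ≤ 1 := by
  have hW := sum_cappedWeight_pos hη1 hm hmN hw
  have hm0 : (0 : ℝ) < m := by exact_mod_cast hm
  have h1η : 0 ≤ 1 - η := by linarith
  by_cases h : NeedsCap η m w
  · rw [← mul_cap_div_add hη1 hm hmN hw h, marginal]
    have : cappedWeight η m w i ≤ cap η m w := by
      rw [cappedWeight_of_needsCap h]; exact min_le_left _ _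
    gcongr
  · have h2 : (1 - η) * w i < (1 / (m : ℝ) - η / N) * ∑ i, w i := by
      by_contra h3
      exact h ⟨i, not_lt.1 h3⟩
    rw [marginal]
    simp only [cappedWeight_of_not_needsCap h] at hW ⊢
    have h3 : (1 - η) * (w i / ∑ j, w j) ≤ 1 / (m : ℝ) - η / N := by
      rw [← mul_div_assoc, div_le_iff₀ hW]; exact h2.le
    calc m * ((1 - η) * (w i / ∑ j, w j) + η / N) ≤ m * (1 / (m : ℝ)) := by
          gcongr; linarith
      _ = 1 := by field_simp

/-- The normalised weight of an uncapped location is controlled by its scanning probability. -/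
theorem weight_div_sum_le (hη0 : 0 < η) (hη1 : η < 1) (hm : 1 ≤ m) (hmN : m < N)
    (hw : ∀ i, 0 < w i) {i : Fin N} (hi : i ∉ cappedSet η m w) :
    w i / ∑ j, w j ≤ marginal η m w i / (m * (1 - η)) := by
  have hW := sum_cappedWeight_pos hη1 hm hmN hw
  have hm0 : (0 : ℝ) < m := by exact_mod_cast hm
  have h1η : 0 < 1 - η := by linarith
  have hN0 : (0 : ℝ) < N := by exact_mod_cast (by omega : 0 < N)
  have h1 : w i / ∑ j, w j ≤ w i / ∑ j, cappedWeight η m w j :=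
    div_le_div_of_nonneg_left (hw i).le hW (Finset.sum_le_sum fun j _ => cappedWeight_le j)
  refine h1.trans ?_
  rw [le_div_iff₀ (by positivity), marginal, cappedWeight, if_neg hi]
  have : 0 ≤ η / N := by positivity
  nlinarith

end Marginal

/-! ### The weights and their potential -/

theorem exp3Weight_congr {N : ℕ} (η : ℝ) {r r' : ℕ → Round N} {t : ℕ}
    (h : ∀ s < t, r s = r' s) : exp3Weight η r t = exp3Weight η r' t := by
  induction t with
  | zero => rfl
  | succ t ih =>
    have h1 := ih fun s hs => h s (hs.trans t.lt_succ_self)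
    funext i
    simp only [exp3Weight, h1, h t t.lt_succ_self]

theorem exp3Weight_pos {N : ℕ} (η : ℝ) (r : ℕ → Round N) (t : ℕ) (i : Fin N) :
    0 < exp3Weight η r t i := by
  induction t with
  | zero => simp [exp3Weight]
  | succ t ih =>
    simp only [exp3Weight]
    split_ifs
    · exact ih
    · exact mul_pos ih (Real.exp_pos _)

/-- The logarithm of the ratio between the sum and the geometric mean of the weights. Its decrease
measures how the defender performs in comparison with scanning uniformly random locations. -/
noncomputable def potential {N : ℕ} (w : Fin N → ℝ) : ℝ :=
  Real.log (∑ i, w i) - 1 / N * ∑ i, Real.log (w i)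

theorem potential_one {N : ℕ} : potential (fun _ : Fin N => 1) = Real.log N := by
  simp [potential]

theorem potential_nonneg {N : ℕ} (hN : 0 < N) {w : Fin N → ℝ} (hw : ∀ i, 0 < w i) :
    0 ≤ potential w := by
  have hN0 : (0 : ℝ) < N := by exact_mod_cast hN
  have h : ∑ i, Real.log (w i) ≤ ∑ _i : Fin N, Real.log (∑ i, w i) :=
    Finset.sum_le_sum fun i _ => Real.log_le_log (hw i)
      (Finset.single_le_sum (fun j _ => (hw j).le) (Finset.mem_univ i))
  simp only [Finset.sum_const, Finset.card_univ, Fintype.card_fin, nsmul_eq_mul] at h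
  rw [potential, sub_nonneg, one_div_mul_eq_div, div_le_iff₀ hN0]
  linarith

/-- The update multiplies only the weight of the attacked location, and only if that location is
scanned and not capped. -/
theorem exp3Weight_succ {N : ℕ} (η : ℝ) (r : ℕ → Round N) (t : ℕ) (i : Fin N) :
    exp3Weight η r (t + 1) i = exp3Weight η r t i * Real.exp
      (if i = (r t).attacked then
        (if (r t).attacked ∈ (r t).scanned ∧
            (r t).attacked ∉ cappedSet η (r t).plays (exp3Weight η r t) then
          (r t).plays * η / (N * marginal η (r t).plays (exp3Weight η r t) (r t).attacked)
        else 0) else 0) := by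
  simp only [exp3Weight, rewardEstimate, Round.attack]
  by_cases hi : i = (r t).attacked
  · subst hi
    by_cases h1 : (r t).attacked ∈ cappedSet η (r t).plays (exp3Weight η r t)
    · simp [h1]
    · by_cases h2 : (r t).attacked ∈ (r t).scanned
      · simp only [h1, h2, if_true, if_false, not_false_eq_true, and_self]
        congr 2
        rw [mul_one_div, div_div, mul_comm (N : ℝ)]
      · simp [h1, h2]
  · simp [hi]

/-- Increasing a single weight, by `log (1 + y) ≤ y` and `exp x ≤ 1 + x + x ^ 2` on `[0, 1]`. -/
theorem potential_mul_exp_single_le {N : ℕ} {w : Fin N → ℝ} (hw : ∀ i, 0 < w i) (k : Fin N)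
    {x : ℝ} (hx0 : 0 ≤ x) (hx1 : x ≤ 1) :
    potential (fun i => w i * Real.exp (if i = k then x else 0)) ≤
      potential w + w k / (∑ i, w i) * (x + x ^ 2) - x / N := by
  have hW : 0 < ∑ i, w i := Finset.sum_pos (fun i _ => hw i) ⟨k, Finset.mem_univ k⟩
  have h1 : ∑ i, w i * Real.exp (if i = k then x else 0) =
      (∑ i, w i) + w k * (Real.exp x - 1) := by
    have : ∀ i, w i * Real.exp (if i = k then x else 0) =
        w i + if i = k then w k * (Real.exp x - 1) else 0 := by
      intro i
      split_ifs with h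
      · subst h; ring
      · simp
    simp [this, Finset.sum_add_distrib]
  have h2 : ∑ i, Real.log (w i * Real.exp (if i = k then x else 0)) =
      ∑ i, Real.log (w i) + x := by
    have : ∀ i, Real.log (w i * Real.exp (if i = k then x else 0)) =
        Real.log (w i) + if i = k then x else 0 := by
      intro i
      rw [Real.log_mul (hw i).ne' (Real.exp_pos _).ne', Real.log_exp]
    simp [this, Finset.sum_add_distrib]
  have h3 : Real.exp x - 1 ≤ x + x ^ 2 := by
    have := (abs_le.1 (Real.abs_exp_sub_one_sub_id_le (abs_le.2 ⟨by linarith, hx1⟩))).2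
    linarith
  have h4 : 0 ≤ Real.exp x - 1 := by linarith [Real.add_one_le_exp x]
  have h5 : Real.log ((∑ i, w i) + w k * (Real.exp x - 1)) ≤
      Real.log (∑ i, w i) + w k / (∑ i, w i) * (x + x ^ 2) := by
    have h6 : (∑ i, w i) + w k * (Real.exp x - 1) =
        (∑ i, w i) * (1 + w k / (∑ i, w i) * (Real.exp x - 1)) := by
      field_simp
    have h7 : 0 ≤ w k / (∑ i, w i) := div_nonneg (hw k).le hW.le
    have h8 : 0 < 1 + w k / (∑ i, w i) * (Real.exp x - 1) := by
      linarith [mul_nonneg h7 h4]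
    rw [h6, Real.log_mul hW.ne' h8.ne']
    have h9 := Real.log_le_sub_one_of_pos h8
    have h10 := mul_le_mul_of_nonneg_left h3 h7
    linarith
  rw [potential, potential, h1, h2]
  have : 1 / (N : ℝ) * (∑ i, Real.log (w i) + x) = 1 / N * ∑ i, Real.log (w i) + x / N := by
    ring
  linarith

/-- The change of the potential in one round of Exp3.M-VP: the first summand comes from the sum of
the weights, the negative one from their geometric mean. -/
theorem potential_exp3Weight_succ_le {N : ℕ} {η : ℝ} (hη0 : 0 < η) (hη1 : η < 1)
    (r : ℕ → Round N) (t : ℕ) (hm : 1 ≤ (r t).plays) (hmN : (r t).plays < N) :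
    potential (exp3Weight η r (t + 1)) ≤ potential (exp3Weight η r t) +
      if (r t).attacked ∈ (r t).scanned ∧
          (r t).attacked ∉ cappedSet η (r t).plays (exp3Weight η r t) then
        η / (N * (1 - η)) + ((r t).plays * η ^ 2 / (N ^ 2 * (1 - η)) -
          (r t).plays * η / N ^ 2) /
            marginal η (r t).plays (exp3Weight η r t) (r t).attacked
      else 0 := by
  have hw := exp3Weight_pos η r t
  rw [funext (exp3Weight_succ η r t)]
  split_ifs with h
  · set k := (r t).attacked
    set m := (r t).plays
    set w := exp3Weight η r t
    set α := marginal η m w k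
    have hα : 0 < α := marginal_pos hη0 hη1 hm hmN hw k
    have hm0 : (0 : ℝ) < m := by exact_mod_cast hm
    have h1η : 0 < 1 - η := by linarith
    have hN0 : (0 : ℝ) < N := by exact_mod_cast (by omega : 0 < N)
    have hx0 : 0 ≤ m * η / (N * α) := by positivity
    -- The exploration term `η / N` of the marginals keeps the exponent below `1`.
    have hx1 : m * η / (N * α) ≤ 1 := by
      rw [div_le_one (by positivity)]
      have := mul_le_mul_of_nonneg_left (le_marginal hη1 hm hmN hw k) hN0.le
      calc m * η = N * (m * (η / N)) := by field_simp
        _ ≤ _ := this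
    refine (potential_mul_exp_single_le hw k hx0 hx1).trans ?_
    have h2 : w k / (∑ i, w i) * (m * η / (N * α) + (m * η / (N * α)) ^ 2) ≤
        α / (m * (1 - η)) * (m * η / (N * α) + (m * η / (N * α)) ^ 2) :=
      mul_le_mul_of_nonneg_right (weight_div_sum_le hη0 hη1 hm hmN hw h.2) (by positivity)
    have h3 : α / (m * (1 - η)) * (m * η / (N * α) + (m * η / (N * α)) ^ 2) -
        m * η / (N * α) / N =
        η / (N * (1 - η)) + (m * η ^ 2 / (N ^ 2 * (1 - η)) - m * η / N ^ 2) / α := by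
      field_simp
      ring
    linarith
  · simp

/-! ### Conditioning on a finite-valued variable -/

section Fiber

variable {Ω β : Type*} [MeasurableSpace Ω] {P : Measure Ω} {Y : Ω → β}

theorem integral_eq_sum_fibers (hY : (Set.range Y).Finite)
    (hYm : ∀ ω₀, MeasurableSet {ω | Y ω = Y ω₀}) {g : Ω → ℝ}
    (hg : ∀ ω₀, IntegrableOn g {ω | Y ω = Y ω₀} P) :
    ∫ ω, g ω ∂P = ∑ y ∈ hY.toFinset, ∫ ω in {ω | Y ω = y}, g ω ∂P := by
  have hU : (⋃ y ∈ hY.toFinset, {ω | Y ω = y}) = Set.univ := by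
    ext ω; simp
  rw [← integral_biUnion_finset, hU, setIntegral_univ]
  · intro y hy
    obtain ⟨ω₀, rfl⟩ := hY.mem_toFinset.1 hy
    exact hYm ω₀
  · intro y _ y' _ hne
    exact Set.disjoint_left.2 fun ω h h' => hne (h.symm.trans h')
  · intro y hy
    obtain ⟨ω₀, rfl⟩ := hY.mem_toFinset.1 hy
    exact hg ω₀

/-- If `c` is the conditional probability of `A` given the finite-valued variable `Y`, and `f` is a
function of `Y`, then `E[f; A] = E[f c]`. -/
theorem integral_indicator_eq_integral_mul [IsFiniteMeasure P] (hY : (Set.range Y).Finite)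
    (hYm : ∀ ω₀, MeasurableSet {ω | Y ω = Y ω₀}) {A : Set Ω} (hA : MeasurableSet A) {f c : Ω → ℝ}
    (hf : ∀ ω ω', Y ω = Y ω' → f ω = f ω') (hc : ∀ ω ω', Y ω = Y ω' → c ω = c ω')
    (h : ∀ ω₀, P.real ({ω | Y ω = Y ω₀} ∩ A) = c ω₀ * P.real {ω | Y ω = Y ω₀}) :
    ∫ ω, A.indicator f ω ∂P = ∫ ω, f ω * c ω ∂P := by
  have e1 : ∀ ω₀, Set.EqOn (A.indicator f) (A.indicator fun _ => f ω₀) {ω | Y ω = Y ω₀} := by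
    intro ω₀ ω hω
    by_cases hωA : ω ∈ A
    · simpa [hωA] using hf ω ω₀ hω
    · simp [hωA]
  have e2 : ∀ ω₀, Set.EqOn (fun ω => f ω * c ω) (fun _ => f ω₀ * c ω₀) {ω | Y ω = Y ω₀} := by
    intro ω₀ ω hω
    simp [hf ω ω₀ hω, hc ω ω₀ hω]
  rw [integral_eq_sum_fibers hY hYm, integral_eq_sum_fibers hY hYm]
  · refine Finset.sum_congr rfl fun y hy => ?_
    obtain ⟨ω₀, rfl⟩ := hY.mem_toFinset.1 hy
    rw [setIntegral_congr_fun (hYm ω₀) (e1 ω₀), setIntegral_congr_fun (hYm ω₀) (e2 ω₀),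
      setIntegral_indicator hA, setIntegral_const, setIntegral_const, h]
    simp only [smul_eq_mul]
    ring
  · intro ω₀
    exact (integrableOn_congr_fun (e2 ω₀) (hYm ω₀)).2 (integrableOn_const (measure_ne_top _ _))
  · intro ω₀
    exact (integrableOn_congr_fun (e1 ω₀) (hYm ω₀)).2
      ((integrable_const _).indicator hA).integrableOn

end Fiber

theorem sum_toReal_pmf {α : Type*} [Fintype α] (Q : PMF α) : ∑ x, (Q x).toReal = 1 := by
  rw [← ENNReal.toReal_sum fun x _ => Q.apply_ne_top x, ← tsum_fintype (L := .unconditional _),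
    Q.tsum_coe, ENNReal.toReal_one]

/-! ### Functions of finitely many rounds -/

/-- `f` is a function of the rounds up to and including round `t`. -/
def DependsOnRounds {N : ℕ} {Ω β : Type*} (X : ℕ → Ω → Round N) (t : ℕ) (f : Ω → β) : Prop :=
  ∀ ω ω', (∀ s ≤ t, X s ω = X s ω') → f ω = f ω'

theorem DependsOnRounds.eq_of_eq {N : ℕ} {Ω β : Type*} {X : ℕ → Ω → Round N} {t : ℕ}
    {f : Ω → β} (hf : DependsOnRounds X t f)
    {ω ω' : Ω} (h : (fun s : Fin (t + 1) => X s ω) = fun s : Fin (t + 1) => X s ω') :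
    f ω = f ω' :=
  hf ω ω' fun s hs => congrFun h ⟨s, Nat.lt_succ_of_le hs⟩

theorem finite_rounds (N b : ℕ) : {r : Round N | r.plays ≤ b}.Finite := by
  refine Set.Finite.of_injOn (f := fun r : Round N => (r.plays, r.attacked, r.scanned))
    (t := Set.Iic b ×ˢ (Set.univ ×ˢ Set.univ)) ?_ ?_
    ((Set.finite_Iic b).prod (Set.finite_univ.prod Set.finite_univ))
  · intro r hr
    simpa using hr
  · rintro ⟨_, _, _⟩ _ ⟨_, _, _⟩ _ h
    simpa using h

/-- The probability that Exp3.M-VP scans location `k` in round `t`, given the past and `M_t`. -/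
noncomputable def scanProb {N : ℕ} {Ω : Type*} (X : ℕ → Ω → Round N) (η : ℝ) (t : ℕ) (k : Fin N)
    (ω : Ω) : ℝ :=
  marginal η (X t ω).plays (exp3Weight η (fun s => X s ω) t) k

theorem scanProb_congr {N : ℕ} {Ω : Type*} {X : ℕ → Ω → Round N} {η : ℝ} {t : ℕ} {ω ω' : Ω}
    (h1 : ∀ s < t, X s ω = X s ω')
    (h2 : (X t ω).plays = (X t ω').plays) (k : Fin N) :
    scanProb X η t k ω = scanProb X η t k ω' := by
  rw [scanProb, scanProb, h2, exp3Weight_congr η h1]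

section Game

variable {N : ℕ} {Ω : Type*} [MeasurableSpace Ω] {P : Measure Ω} {X : ℕ → Ω → Round N}
  {T a b : ℕ} {D : (Fin N → ℝ) → PMF (Finset (Fin N))} {η : ℝ} {π : AttackerPolicy N}

theorem IsGame.finite_range_rounds (hX : IsGame P X T a b D η π) {t : ℕ} (ht : t < T) :
    (Set.range fun ω (s : Fin (t + 1)) => X s ω).Finite := by
  refine (Set.Finite.pi' fun _ : Fin (t + 1) => finite_rounds N b).subset ?_
  rintro _ ⟨ω, rfl⟩ s
  exact (hX.plays_mem s (by omega) ω).2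

theorem DependsOnRounds.finite_range (hX : IsGame P X T a b D η π) {t : ℕ} (ht : t < T)
    {β : Type*} {f : Ω → β} (hf : DependsOnRounds X t f) : (Set.range f).Finite := by
  rcases isEmpty_or_nonempty Ω with _ | ⟨⟨ω₀⟩⟩
  · rw [Set.range_eq_empty]
    exact Set.finite_empty
  refine ((hX.finite_range_rounds ht).image
    (Function.extend (fun ω (s : Fin (t + 1)) => X s ω) f fun _ => f ω₀)).subset ?_
  rintro _ ⟨ω, rfl⟩
  refine ⟨_, ⟨ω, rfl⟩, Function.FactorsThrough.extend_apply ?_ _ ω⟩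
  intro ω₁ ω₂ h
  exact hf.eq_of_eq h

theorem IsGame.measurableSet_round (hX : IsGame P X T a b D η π) (s : ℕ) (p : Round N → Prop) :
    MeasurableSet {ω | p (X s ω)} :=
  @hX.measurable s {x | p x} trivial

theorem DependsOnRounds.measurableSet (hX : IsGame P X T a b D η π) {t : ℕ} (ht : t < T)
    {p : Ω → Prop} (hp : DependsOnRounds X t p) : MeasurableSet {ω | p ω} := by
  have h1 : {ω | p ω} = ⋃ y ∈ (fun ω (s : Fin (t + 1)) => X s ω) '' {ω | p ω},
      {ω | (fun s : Fin (t + 1) => X s ω) = y} := by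
    ext ω
    simp only [Set.mem_ofPred_eq, Set.mem_iUnion, exists_prop]
    constructor
    · exact fun h => ⟨_, ⟨ω, h, rfl⟩, rfl⟩
    · rintro ⟨_, ⟨ω', h', rfl⟩, h⟩
      exact (hp.eq_of_eq h).symm ▸ h'
  rw [h1]
  refine ((hX.finite_range_rounds ht).subset (Set.image_subset_range _ _)).measurableSet_biUnion
    fun y _ => ?_
  have h2 : {ω | (fun s : Fin (t + 1) => X s ω) = y} = ⋂ s : Fin (t + 1), {ω | X s ω = y s} := by
    ext ω; simp [funext_iff]
  rw [h2]
  exact MeasurableSet.iInter fun s => hX.measurableSet_round s (· = y s)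

theorem DependsOnRounds.integrable [IsFiniteMeasure P] (hX : IsGame P X T a b D η π) {t : ℕ}
    (ht : t < T) {f : Ω → ℝ} (hf : DependsOnRounds X t f) : Integrable f P := by
  let g : SimpleFunc Ω ℝ := ⟨f, fun x => DependsOnRounds.measurableSet hX ht (p := fun ω => f ω = x)
    fun ω ω' h => congrArg (· = x) (hf ω ω' h), hf.finite_range hX ht⟩
  exact g.integrable_of_isFiniteMeasure

/-! ### One round of the game -/

/-- Given the past and `M_t`, the location `I_t` and the set `J_t` are independent with the laws
prescribed by the policy of the attacker and by the algorithm of the defender. -/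
theorem IsGame.measureReal_round [IsFiniteMeasure P] (hX : IsGame P X T a b D η π) {t : ℕ}
    (ht : t < T) (r : ℕ → Round N) (m : ℕ) (A : Finset (Fin N)) (S : Finset (Finset (Fin N))) :
    P.real {ω | ((∀ s < t, X s ω = r s) ∧ (X t ω).plays = m) ∧
        (X t ω).attacked ∈ A ∧ (X t ω).scanned ∈ S} =
      P.real {ω | (∀ s < t, X s ω = r s) ∧ (X t ω).plays = m} *
        ((∑ i ∈ A, (π t (fun s => ((r s).attacked, evasion (r s).scanned (r s).attacked))
            i).toReal) *
          ∑ J ∈ S, (D (marginal η m (exp3Weight η r t)) J).toReal) := by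
  -- For a single outcome `(i, J)` this is `hX.law` for a path whose round `t` is `(m, i, J)`.
  have hatom : ∀ i J, P.real {ω | ((∀ s < t, X s ω = r s) ∧ (X t ω).plays = m) ∧
        (X t ω).attacked = i ∧ (X t ω).scanned = J} =
      P.real {ω | (∀ s < t, X s ω = r s) ∧ (X t ω).plays = m} *
        ((π t (fun s => ((r s).attacked, evasion (r s).scanned (r s).attacked)) i).toReal *
          (D (marginal η m (exp3Weight η r t)) J).toReal) := by
    intro i J
    have hlaw := hX.law t ht (Function.update r t ⟨m, i, J⟩)
    have hlt : ∀ s < t, Function.update r t ⟨m, i, J⟩ s = r s := fun s hs =>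
      Function.update_of_ne hs.ne _ _
    have e1 : {ω | ∀ s ≤ t, X s ω = Function.update r t ⟨m, i, J⟩ s} =
        {ω | ((∀ s < t, X s ω = r s) ∧ (X t ω).plays = m) ∧
          (X t ω).attacked = i ∧ (X t ω).scanned = J} := by
      ext ω
      simp only [Set.mem_ofPred_eq]
      constructor
      · intro h
        have h1 := h t le_rfl
        rw [Function.update_self] at h1
        refine ⟨⟨fun s hs => (h s hs.le).trans (hlt s hs), ?_⟩, ?_, ?_⟩ <;> rw [h1]
      · rintro ⟨⟨h1, h2⟩, h3, h4⟩ s hs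
        rcases hs.lt_or_eq with hs | rfl
        · rw [hlt s hs, h1 s hs]
        · rw [Function.update_self, ← h2, ← h3, ← h4]
    have e2 : {ω | (∀ s < t, X s ω = Function.update r t ⟨m, i, J⟩ s) ∧
          (X t ω).plays = (Function.update r t ⟨m, i, J⟩ t).plays} =
        {ω | (∀ s < t, X s ω = r s) ∧ (X t ω).plays = m} := by
      ext ω
      simp only [Set.mem_ofPred_eq, Function.update_self]
      refine and_congr_left fun _ => forall₂_congr fun s hs => ?_
      rw [hlt s hs]
    have e3 : (fun s : Fin t => ((Function.update r t ⟨m, i, J⟩ s).attacked,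
          evasion (Function.update r t ⟨m, i, J⟩ s).scanned
            (Function.update r t ⟨m, i, J⟩ s).attacked)) =
        fun s : Fin t => ((r s).attacked, evasion (r s).scanned (r s).attacked) := by
      funext s
      rw [hlt s s.2]
    rw [e1, e2, e3, exp3MVP, exp3Weight_congr η hlt, Function.update_self] at hlaw
    rw [Measure.real, hlaw, ENNReal.toReal_mul, ENNReal.toReal_mul]
    rfl
  have hU : {ω | ((∀ s < t, X s ω = r s) ∧ (X t ω).plays = m) ∧
        (X t ω).attacked ∈ A ∧ (X t ω).scanned ∈ S} =
      ⋃ x ∈ A ×ˢ S, {ω | ((∀ s < t, X s ω = r s) ∧ (X t ω).plays = m) ∧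
        (X t ω).attacked = x.1 ∧ (X t ω).scanned = x.2} := by
    ext ω
    simp only [Set.mem_ofPred_eq, Set.mem_iUnion, exists_prop, Finset.mem_product]
    constructor
    · rintro ⟨h1, h2⟩
      exact ⟨(_, _), h2, h1, rfl, rfl⟩
    · rintro ⟨x, hx, h1, h2, h3⟩
      exact ⟨h1, h2 ▸ hx.1, h3 ▸ hx.2⟩
  rw [hU, measureReal_biUnion_finset, Finset.sum_mul_sum, ← Finset.sum_product', Finset.mul_sum]
  · exact Finset.sum_congr rfl fun x _ => hatom x.1 x.2
  · intro x _ y _ hne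
    refine Set.disjoint_left.2 fun ω h h' => hne ?_
    exact Prod.ext (h.2.1.symm.trans h'.2.1) (h.2.2.symm.trans h'.2.2)
  · intro x _
    refine DependsOnRounds.measurableSet hX ht fun ω ω' h => ?_
    have h1 : ∀ s < t, X s ω = X s ω' := fun s hs => h s hs.le
    rw [h t le_rfl]
    congr 2
    exact propext ⟨fun h2 s hs => h1 s hs ▸ h2 s hs, fun h2 s hs => (h1 s hs).symm ▸ h2 s hs⟩

theorem IsGame.sum_mem_eq_scanProb (hX : IsGame P X T a b D η π) (hD : IsDepRound D)
    (hη1 : η < 1) (hη0 : 0 < η) (ha : 1 ≤ a) (hbN : b < N) {t : ℕ} (ht : t < T) (k : Fin N)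
    (ω : Ω) : ∑ J with k ∈ J, (D (marginal η (X t ω).plays
      (exp3Weight η (fun s => X s ω) t)) J).toReal = scanProb X η t k ω := by
  obtain ⟨h1, h2⟩ := hX.plays_mem t ht ω
  have hw := exp3Weight_pos η (fun s => X s ω) t
  have hm : 1 ≤ (X t ω).plays := ha.trans h1
  have hmN : (X t ω).plays < N := h2.trans_lt hbN
  have hp : ∀ i, 0 ≤ marginal η (X t ω).plays (exp3Weight η (fun s => X s ω) t) i ∧
      marginal η (X t ω).plays (exp3Weight η (fun s => X s ω) t) i ≤ 1 := fun i =>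
    ⟨(marginal_pos hη0 hη1 hm hmN hw i).le, marginal_le_one hη1 hm hmN hw i⟩
  exact (hD _ _ hp (sum_marginal hη1 hm hmN hw)).sum_mem hp k

variable [IsProbabilityMeasure P]

/-- The attacker's choices follow the policy when the defender, together with the random numbers
`M_t`, is regarded as a single adaptive opponent. -/
theorem IsGame.followsPolicy (hX : IsGame P X T a b D η π) :
    FollowsPolicy P T π (fun t ω => (X t ω).attacked) (fun t ω => (X t ω).scanned) := by
  intro t ht i c
  set B := {ω | (∀ s < t, (X s ω).attacked = i s ∧ (X s ω).scanned = c s) ∧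
    (X t ω).scanned = c t} with hB
  set A := {ω | (X t ω).attacked = i t} with hA
  set q : Ω → ℝ := fun ω => (π t (fun s => ((X s ω).attacked,
    evasion (X s ω).scanned (X s ω).attacked)) (i t)).toReal with hq
  -- Condition on the past, `M_t` and `J_t`: then `I_t` has the law `π t`, which depends on the past
  -- only through the attacker's own choices and rewards, hence is constant on `B`.
  let Y : Ω → (Fin t → Round N) × ℕ × Finset (Fin N) :=
    fun ω => (fun s => X s ω, (X t ω).plays, (X t ω).scanned)
  have hYiff : ∀ ω ω', Y ω = Y ω' ↔ (∀ s < t, X s ω = X s ω') ∧ (X t ω).plays = (X t ω').plays ∧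
      (X t ω).scanned = (X t ω').scanned := by
    intro ω ω'
    simp only [Y, Prod.mk.injEq, funext_iff, Fin.forall_iff]
  have hYdep : DependsOnRounds X t Y := by
    intro ω ω' h
    rw [hYiff, h t le_rfl]
    exact ⟨fun s hs => h s hs.le, rfl, rfl⟩
  have hAm : MeasurableSet A := hX.measurableSet_round t (·.attacked = i t)
  have hBY : ∀ ω ω', Y ω = Y ω' → (ω ∈ B ↔ ω' ∈ B) := by
    intro ω ω' h
    obtain ⟨h1, -, h3⟩ := (hYiff _ _).1 h
    simp only [hB, Set.mem_ofPred_eq, h3]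
    refine and_congr_left fun _ => forall₂_congr fun s hs => ?_
    rw [h1 s hs]
  have hBm : MeasurableSet B := DependsOnRounds.measurableSet hX ht (p := (· ∈ B))
    fun ω ω' h => propext (hBY _ _ (hYdep _ _ h))
  have hqY : ∀ ω ω', Y ω = Y ω' → q ω = q ω' := by
    intro ω ω' h
    have : (fun s : Fin t => X s ω) = fun s : Fin t => X s ω' := congrArg Prod.fst h
    have h1 : ∀ s : Fin t, X s ω = X s ω' := congrFun this
    simp only [hq, h1]
  have key := integral_indicator_eq_integral_mul (P := P) (Y := Y) (A := A)
    (f := B.indicator 1) (c := q) (hYdep.finite_range hX ht)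
    (fun ω₀ => DependsOnRounds.measurableSet hX ht fun ω ω' h => by rw [hYdep ω ω' h]) hAm
    (fun ω ω' h => by
      by_cases hω : ω ∈ B
      · simp [hω, (hBY _ _ h).1 hω]
      · simp [hω, mt (hBY _ _ h).2 hω]) hqY ?_
  · have e1 : ∫ ω, A.indicator (B.indicator (1 : Ω → ℝ)) ω ∂P = P.real (A ∩ B) := by
      rw [Set.indicator_indicator, integral_indicator_one (hAm.inter hBm)]
    have e2 : ∀ ω, B.indicator (1 : Ω → ℝ) ω * q ω = B.indicator (fun _ =>
        (π t (fun s => (i s, evasion (c s) (i s))) (i t)).toReal) ω := by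
      intro ω
      by_cases hω : ω ∈ B
      · simp only [hω, Set.indicator_of_mem, Pi.one_apply, one_mul, hq]
        congr 3
        funext s
        rw [(hω.1 s s.2).1, (hω.1 s s.2).2]
      · simp [hω]
    simp only [e2] at key
    rw [e1, integral_indicator_const _ hBm, smul_eq_mul] at key
    have e3 : {ω | ∀ s ≤ t, (X s ω).attacked = i s ∧ (X s ω).scanned = c s} = A ∩ B := by
      ext ω
      simp only [hA, hB, Set.mem_ofPred_eq, Set.mem_inter_iff]
      constructor
      · exact fun h => ⟨(h t le_rfl).1, fun s hs => h s hs.le, (h t le_rfl).2⟩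
      · rintro ⟨h1, h2, h3⟩ s hs
        rcases hs.lt_or_eq with hs | rfl
        · exact h2 s hs
        · exact ⟨h1, h3⟩
    rw [e3, ← ENNReal.toReal_eq_toReal_iff' (measure_ne_top _ _)
      (ENNReal.mul_ne_top (measure_ne_top _ _) (PMF.apply_ne_top _ _)), ENNReal.toReal_mul]
    exact key
  · intro ω₀
    have h1 := hX.measureReal_round ht (fun s => X s ω₀) (X t ω₀).plays {i t} {(X t ω₀).scanned}
    have h2 := hX.measureReal_round ht (fun s => X s ω₀) (X t ω₀).plays Finset.univ
      {(X t ω₀).scanned}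
    have e1 : {ω | Y ω = Y ω₀} ∩ A = {ω | ((∀ s < t, X s ω = X s ω₀) ∧
        (X t ω).plays = (X t ω₀).plays) ∧ (X t ω).attacked ∈ ({i t} : Finset (Fin N)) ∧
        (X t ω).scanned ∈ ({(X t ω₀).scanned} : Finset _)} := by
      ext ω
      simp only [Set.mem_inter_iff, Set.mem_ofPred_eq, hYiff, hA, Finset.mem_singleton]
      tauto
    have e2 : {ω | Y ω = Y ω₀} = {ω | ((∀ s < t, X s ω = X s ω₀) ∧
        (X t ω).plays = (X t ω₀).plays) ∧ (X t ω).attacked ∈ (Finset.univ : Finset (Fin N)) ∧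
        (X t ω).scanned ∈ ({(X t ω₀).scanned} : Finset _)} := by
      ext ω
      simp only [Set.mem_ofPred_eq, hYiff, Finset.mem_singleton, Finset.mem_univ, true_and]
      tauto
    rw [e1, e2, h1, h2, sum_toReal_pmf]
    simp only [Finset.sum_singleton, hq]
    ring

/-- Given the past, `M_t` and `I_t`, the attacked location is scanned with probability
`scanProb`. -/
theorem IsGame.integral_indicator_attacked_mem (hX : IsGame P X T a b D η π)
    (hD : IsDepRound D) (hη0 : 0 < η) (hη1 : η < 1) (ha : 1 ≤ a) (hbN : b < N) {t : ℕ}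
    (ht : t < T) {f : Ω → ℝ} (hf : ∀ ω ω', (∀ s < t, X s ω = X s ω') →
      (X t ω).plays = (X t ω').plays → (X t ω).attacked = (X t ω').attacked → f ω = f ω') :
    ∫ ω, {ω | (X t ω).attacked ∈ (X t ω).scanned}.indicator f ω ∂P =
      ∫ ω, f ω * scanProb X η t (X t ω).attacked ω ∂P := by
  let Y : Ω → (Fin t → Round N) × ℕ × Fin N :=
    fun ω => (fun s => X s ω, (X t ω).plays, (X t ω).attacked)
  have hYiff : ∀ ω ω', Y ω = Y ω' ↔ (∀ s < t, X s ω = X s ω') ∧ (X t ω).plays = (X t ω').plays ∧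
      (X t ω).attacked = (X t ω').attacked := by
    intro ω ω'
    simp only [Y, Prod.mk.injEq, funext_iff, Fin.forall_iff]
  have hYdep : DependsOnRounds X t Y := by
    intro ω ω' h
    rw [hYiff, h t le_rfl]
    exact ⟨fun s hs => h s hs.le, rfl, rfl⟩
  refine integral_indicator_eq_integral_mul (Y := Y) (hYdep.finite_range hX ht)
    (fun ω₀ => DependsOnRounds.measurableSet hX ht fun ω ω' h => by rw [hYdep ω ω' h])
    (hX.measurableSet_round t fun r => r.attacked ∈ r.scanned) ?_ ?_ ?_
  · intro ω ω' h
    obtain ⟨h1, h2, h3⟩ := (hYiff _ _).1 h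
    exact hf _ _ h1 h2 h3
  · intro ω ω' h
    obtain ⟨h1, h2, h3⟩ := (hYiff _ _).1 h
    rw [h3, scanProb_congr h1 h2]
  · intro ω₀
    have h1 := hX.measureReal_round ht (fun s => X s ω₀) (X t ω₀).plays {(X t ω₀).attacked}
      (Finset.univ.filter fun J => (X t ω₀).attacked ∈ J)
    have h2 := hX.measureReal_round ht (fun s => X s ω₀) (X t ω₀).plays {(X t ω₀).attacked}
      Finset.univ
    have e1 : {ω | Y ω = Y ω₀} ∩ {ω | (X t ω).attacked ∈ (X t ω).scanned} =
        {ω | ((∀ s < t, X s ω = X s ω₀) ∧ (X t ω).plays = (X t ω₀).plays) ∧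
          (X t ω).attacked ∈ ({(X t ω₀).attacked} : Finset (Fin N)) ∧
          (X t ω).scanned ∈ Finset.univ.filter fun J => (X t ω₀).attacked ∈ J} := by
      ext ω
      simp only [Set.mem_inter_iff, Set.mem_ofPred_eq, hYiff, Finset.mem_singleton,
        Finset.mem_filter, Finset.mem_univ, true_and]
      constructor
      · rintro ⟨⟨h1, h2, h3⟩, h4⟩
        exact ⟨⟨h1, h2⟩, h3, h3 ▸ h4⟩
      · rintro ⟨⟨h1, h2⟩, h3, h4⟩
        exact ⟨⟨h1, h2, h3⟩, h3.symm ▸ h4⟩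
    have e2 : {ω | Y ω = Y ω₀} = {ω | ((∀ s < t, X s ω = X s ω₀) ∧
        (X t ω).plays = (X t ω₀).plays) ∧
        (X t ω).attacked ∈ ({(X t ω₀).attacked} : Finset (Fin N)) ∧
        (X t ω).scanned ∈ (Finset.univ : Finset (Finset (Fin N)))} := by
      ext ω
      simp only [Set.mem_ofPred_eq, hYiff, Finset.mem_singleton, Finset.mem_univ, and_true]
      tauto
    rw [e1, e2, h1, h2, sum_toReal_pmf,
      hX.sum_mem_eq_scanProb hD hη1 hη0 ha hbN ht]
    ring

/-- `|J_t|` and `M_t` have the same mean, since the marginals given the past sum to `M_t`. -/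
theorem IsGame.integral_scanned_card (hX : IsGame P X T a b D η π)
    (hD : IsDepRound D) (hη0 : 0 < η) (hη1 : η < 1) (ha : 1 ≤ a) (hbN : b < N) {t : ℕ}
    (ht : t < T) : ∫ ω, ((X t ω).scanned.card : ℝ) ∂P = ∫ ω, ((X t ω).plays : ℝ) ∂P := by
  let Y : Ω → (Fin t → Round N) × ℕ := fun ω => (fun s => X s ω, (X t ω).plays)
  have hYiff : ∀ ω ω', Y ω = Y ω' ↔ (∀ s < t, X s ω = X s ω') ∧
      (X t ω).plays = (X t ω').plays := by
    intro ω ω'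
    simp only [Y, Prod.mk.injEq, funext_iff, Fin.forall_iff]
  have hYdep : DependsOnRounds X t Y := by
    intro ω ω' h
    rw [hYiff, h t le_rfl]
    exact ⟨fun s hs => h s hs.le, rfl⟩
  have key : ∀ k : Fin N, ∫ ω, {ω | k ∈ (X t ω).scanned}.indicator (fun _ => (1 : ℝ)) ω ∂P =
      ∫ ω, 1 * scanProb X η t k ω ∂P := by
    intro k
    refine integral_indicator_eq_integral_mul (Y := Y) (hYdep.finite_range hX ht)
      (fun ω₀ => DependsOnRounds.measurableSet hX ht fun ω ω' h => by rw [hYdep ω ω' h])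
      (hX.measurableSet_round t fun r => k ∈ r.scanned) (fun _ _ _ => rfl) ?_ ?_
    · intro ω ω' h
      obtain ⟨h1, h2⟩ := (hYiff _ _).1 h
      rw [scanProb_congr h1 h2]
    · intro ω₀
      have h1 := hX.measureReal_round ht (fun s => X s ω₀) (X t ω₀).plays Finset.univ
        (Finset.univ.filter fun J => k ∈ J)
      have e1 : {ω | Y ω = Y ω₀} ∩ {ω | k ∈ (X t ω).scanned} =
          {ω | ((∀ s < t, X s ω = X s ω₀) ∧ (X t ω).plays = (X t ω₀).plays) ∧
            (X t ω).attacked ∈ (Finset.univ : Finset (Fin N)) ∧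
            (X t ω).scanned ∈ Finset.univ.filter fun J => k ∈ J} := by
        ext ω
        simp only [Set.mem_inter_iff, Set.mem_ofPred_eq, hYiff, Finset.mem_filter,
          Finset.mem_univ, true_and]
      have e2 : {ω | Y ω = Y ω₀} = {ω | (∀ s < t, X s ω = X s ω₀) ∧
          (X t ω).plays = (X t ω₀).plays} := by
        ext ω
        simp only [Set.mem_ofPred_eq, hYiff]
      rw [e1, e2, h1, sum_toReal_pmf, hX.sum_mem_eq_scanProb hD hη1 hη0 ha hbN ht]
      ring
  have hcard : ∀ ω, ((X t ω).scanned.card : ℝ) =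
      ∑ k, {ω | k ∈ (X t ω).scanned}.indicator (fun _ => (1 : ℝ)) ω := by
    intro ω
    simp [Set.indicator_apply]
  have hsum : ∀ ω, ((X t ω).plays : ℝ) = ∑ k, 1 * scanProb X η t k ω := by
    intro ω
    obtain ⟨h1, h2⟩ := hX.plays_mem t ht ω
    simp only [one_mul, scanProb]
    exact (sum_marginal hη1 (ha.trans h1) (h2.trans_lt hbN)
      (exp3Weight_pos η (fun s => X s ω) t)).symm
  simp only [hcard, hsum]
  rw [integral_finsetSum, integral_finsetSum]
  · exact Finset.sum_congr rfl fun k _ => key k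
  · intro k _
    refine DependsOnRounds.integrable hX ht fun ω ω' h => ?_
    rw [scanProb_congr (fun s hs => h s hs.le) (by rw [h t le_rfl])]
  · intro k _
    refine DependsOnRounds.integrable hX ht fun ω ω' h => ?_
    simp only [Set.indicator_apply, Set.mem_ofPred_eq, h t le_rfl]

end Game

/-! ### Bounds on the defender's expected reward for a fixed horizon -/

theorem Round.defenderReward_eq {N : ℕ} (r : Round N) :
    r.defenderReward = if r.attacked ∈ r.scanned then 1 else 0 := by
  simp [Round.defenderReward, Round.attack]

theorem evasion_attacked {N : ℕ} (r : Round N) :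
    evasion r.scanned r.attacked = 1 - r.defenderReward := by
  rw [evasion, r.defenderReward_eq]
  split_ifs <;> simp

theorem sum_evasion {N : ℕ} (S : Finset (Fin N)) : ∑ k, evasion S k = N - S.card := by
  have h : ∀ k, evasion S k = 1 - if k ∈ S then 1 else 0 := by
    intro k
    rw [evasion]
    split_ifs <;> simp
  simp [h]

section Bounds

variable {N : ℕ} {Ω : Type*} [MeasurableSpace Ω] {P : Measure Ω}
  {X : ℕ → Ω → Round N} {T a b : ℕ} {D : (Fin N → ℝ) → PMF (Finset (Fin N))} {η : ℝ}
  {π : AttackerPolicy N} {ν : ℝ}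

/-- The bound of `potential_exp3Weight_succ_le` for the increase of the potential in round `t`. -/
noncomputable def potentialIncrement {N : ℕ} {Ω : Type*} (η : ℝ) (X : ℕ → Ω → Round N)
    (t : ℕ) (ω : Ω) : ℝ :=
  if (X t ω).attacked ∈ (X t ω).scanned ∧
      (X t ω).attacked ∉ cappedSet η (X t ω).plays (exp3Weight η (fun s => X s ω) t) then
    η / (N * (1 - η)) + ((X t ω).plays * η ^ 2 / (N ^ 2 * (1 - η)) -
      (X t ω).plays * η / N ^ 2) / scanProb X η t (X t ω).attacked ω
  else 0

theorem IsGame.sum_potentialIncrement_nonneg (hX : IsGame P X T a b D η π)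
    (hη0 : 0 < η) (hη1 : η < 1) (ha : 1 ≤ a) (hbN : b < N) (ω : Ω) :
    0 ≤ Real.log N + ∑ t ∈ Finset.range T, potentialIncrement η X t ω := by
  have h : ∀ n ≤ T, potential (exp3Weight η (fun s => X s ω) n) ≤
      Real.log N + ∑ t ∈ Finset.range n, potentialIncrement η X t ω := by
    intro n
    induction n with
    | zero =>
      intro _
      simp [exp3Weight, potential_one]
    | succ n ih =>
      intro hn
      obtain ⟨h1, h2⟩ := hX.plays_mem n hn ω
      have h3 := potential_exp3Weight_succ_le hη0 hη1 (fun s => X s ω) n (ha.trans h1)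
        (h2.trans_lt hbN)
      rw [Finset.sum_range_succ]
      have h4 := ih (by omega)
      simp only [potentialIncrement, scanProb] at h4 ⊢
      linarith
  exact (potential_nonneg (by omega) (exp3Weight_pos η _ T)).trans (h T le_rfl)

variable [IsProbabilityMeasure P]

theorem IsGame.integrable_round (hX : IsGame P X T a b D η π) {t : ℕ} (ht : t < T)
    (f : Round N → ℝ) : Integrable (fun ω => f (X t ω)) P :=
  DependsOnRounds.integrable hX ht fun ω ω' h => by rw [h t le_rfl]

theorem IsGame.integral_sum_round (hX : IsGame P X T a b D η π) (f : Round N → ℝ) :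
    ∫ ω, ∑ t ∈ Finset.range T, f (X t ω) ∂P = ∑ t ∈ Finset.range T, ∫ ω, f (X t ω) ∂P :=
  integral_finsetSum _ fun _ ht => hX.integrable_round (Finset.mem_range.1 ht) f

/-- An attacker whose pseudo-regret is at most `R` evades at least as often, up to `R`, as one
staying at a uniformly random location, and such a location is scanned with probability `ν / N`. -/
theorem IsGame.integral_reward_le (hX : IsGame P X T a b D η π) (hD : IsDepRound D)
    (hη0 : 0 < η) (hη1 : η < 1) (ha : 1 ≤ a) (hbN : b < N)
    (hν : ∀ t < T, ∫ ω, ((X t ω).plays : ℝ) ∂P = ν) {R : ℝ}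
    (hR : ∀ k : Fin N, ∫ ω, ∑ t ∈ Finset.range T, evasion (X t ω).scanned k ∂P -
      ∫ ω, ∑ t ∈ Finset.range T, evasion (X t ω).scanned (X t ω).attacked ∂P ≤ R) :
    ∫ ω, ∑ t ∈ Finset.range T, (X t ω).defenderReward ∂P ≤ ν * T / N + R := by
  have hN0 : (0 : ℝ) < N := by exact_mod_cast (by omega : 0 < N)
  have e1 : ∫ ω, ∑ t ∈ Finset.range T, evasion (X t ω).scanned (X t ω).attacked ∂P =
      T - ∫ ω, ∑ t ∈ Finset.range T, (X t ω).defenderReward ∂P := by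
    simp only [evasion_attacked, Finset.sum_sub_distrib]
    rw [integral_sub (integrable_const _)
      (integrable_finsetSum _ fun t ht => hX.integrable_round (Finset.mem_range.1 ht) _)]
    simp
  have e2 : ∑ k : Fin N, ∫ ω, ∑ t ∈ Finset.range T, evasion (X t ω).scanned k ∂P =
      N * T - ν * T := by
    have h1 : ∀ t ∈ Finset.range T,
        ∑ k : Fin N, ∫ ω, evasion (X t ω).scanned k ∂P = N - ν := by
      intro t ht
      have ht' := Finset.mem_range.1 ht
      rw [← integral_finsetSum _ fun k _ =>
        hX.integrable_round ht' fun r => evasion r.scanned k]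
      simp only [sum_evasion]
      rw [integral_sub (integrable_const _)
        (hX.integrable_round ht' fun r => (r.scanned.card : ℝ)),
        hX.integral_scanned_card hD hη0 hη1 ha hbN ht', hν t ht']
      simp
    rw [Finset.sum_congr rfl fun k _ => hX.integral_sum_round fun r => evasion r.scanned k,
      Finset.sum_comm, Finset.sum_congr rfl h1]
    simp only [Finset.sum_const, Finset.card_range, nsmul_eq_mul]
    ring
  have h3 := Finset.sum_le_sum fun k (_ : k ∈ Finset.univ) => hR k
  rw [Finset.sum_sub_distrib, e2, e1] at h3
  simp only [Finset.sum_const, Finset.card_univ, Fintype.card_fin, nsmul_eq_mul] at h3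
  rw [← sub_le_iff_le_add, le_div_iff₀ hN0]
  linarith

theorem IsGame.integrable_potentialIncrement (hX : IsGame P X T a b D η π) {t : ℕ} (ht : t < T) :
    Integrable (potentialIncrement η X t) P := by
  refine DependsOnRounds.integrable hX ht fun ω ω' h => ?_
  have h1 : exp3Weight η (fun s => X s ω) t = exp3Weight η (fun s => X s ω') t :=
    exp3Weight_congr η fun s hs => h s hs.le
  simp only [potentialIncrement, scanProb, h1, h t le_rfl]

/-- In expectation the importance weights cancel. Rounds in which a capped location is attacked do
not change the weights, but in these rounds the defender's reward is `1 ≥ M_t / N`. -/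
theorem IsGame.integral_potentialIncrement_le (hX : IsGame P X T a b D η π) (hD : IsDepRound D)
    (hη0 : 0 < η) (hη1 : η < 1) (ha : 1 ≤ a) (hbN : b < N) {t : ℕ} (ht : t < T) :
    ∫ ω, potentialIncrement η X t ω ∂P ≤
      η / (N * (1 - η)) * ∫ ω, (X t ω).defenderReward ∂P +
        b * η ^ 2 / (N ^ 2 * (1 - η)) - η / N ^ 2 * ∫ ω, ((X t ω).plays : ℝ) ∂P := by
  have hN0 : (0 : ℝ) < N := by exact_mod_cast (by omega : 0 < N)
  have h1η : 0 < 1 - η := by linarith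
  set f : Ω → ℝ := fun ω =>
    if (X t ω).attacked ∈ cappedSet η (X t ω).plays (exp3Weight η (fun s => X s ω) t) then 0
    else η / (N * (1 - η)) + ((X t ω).plays * η ^ 2 / (N ^ 2 * (1 - η)) -
      (X t ω).plays * η / N ^ 2) / scanProb X η t (X t ω).attacked ω with hf
  have hfcongr : ∀ ω ω', (∀ s < t, X s ω = X s ω') → (X t ω).plays = (X t ω').plays →
      (X t ω).attacked = (X t ω').attacked → f ω = f ω' := by
    intro ω ω' h1 h2 h3
    have h4 : exp3Weight η (fun s => X s ω) t = exp3Weight η (fun s => X s ω') t :=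
      exp3Weight_congr η h1
    simp only [hf, scanProb, h2, h3, h4]
  have e1 : ∀ ω, potentialIncrement η X t ω =
      {ω | (X t ω).attacked ∈ (X t ω).scanned}.indicator f ω := by
    intro ω
    simp only [potentialIncrement, Set.indicator_apply, Set.mem_ofPred_eq, hf, ite_and]
    split_ifs <;> simp_all
  have e2 : ∀ ω, (X t ω).defenderReward =
      {ω | (X t ω).attacked ∈ (X t ω).scanned}.indicator (fun _ => (1 : ℝ)) ω := by
    intro ω
    simp only [Round.defenderReward_eq, Set.indicator_apply, Set.mem_ofPred_eq]
  have hα : Integrable (fun ω => scanProb X η t (X t ω).attacked ω) P :=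
    DependsOnRounds.integrable hX ht fun ω ω' h => by
      rw [h t le_rfl, scanProb_congr (fun s hs => h s hs.le) (by rw [h t le_rfl])]
  have hpl := hX.integrable_round ht fun r => (r.plays : ℝ)
  have e3 := hX.integral_indicator_attacked_mem hD hη0 hη1 ha hbN ht hfcongr
  have e4 := hX.integral_indicator_attacked_mem hD hη0 hη1 ha hbN ht (f := fun _ => (1 : ℝ))
    fun _ _ _ _ _ => rfl
  simp only [one_mul] at e4
  simp only [e1, e2]
  rw [e3, e4]
  have hint : Integrable (fun ω => η / (N * (1 - η)) * scanProb X η t (X t ω).attacked ω +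
      b * η ^ 2 / (N ^ 2 * (1 - η))) P := (hα.const_mul _).add (integrable_const _)
  calc ∫ ω, f ω * scanProb X η t (X t ω).attacked ω ∂P
      ≤ ∫ ω, (η / (N * (1 - η)) * scanProb X η t (X t ω).attacked ω +
          b * η ^ 2 / (N ^ 2 * (1 - η)) - η / N ^ 2 * ((X t ω).plays : ℝ)) ∂P := by
        refine integral_mono ?_ (hint.sub (hpl.const_mul _)) fun ω => ?_
        · refine DependsOnRounds.integrable hX ht fun ω ω' h => ?_
          rw [hfcongr ω ω' (fun s hs => h s hs.le) (by rw [h t le_rfl]) (by rw [h t le_rfl]),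
            h t le_rfl, scanProb_congr (fun s hs => h s hs.le) (by rw [h t le_rfl])]
        obtain ⟨h1, h2⟩ := hX.plays_mem t ht ω
        have hw := exp3Weight_pos η (fun s => X s ω) t
        have hm := ha.trans h1
        have hmN := h2.trans_lt hbN
        have hmb : ((X t ω).plays : ℝ) ≤ b := by exact_mod_cast h2
        have hmN' : ((X t ω).plays : ℝ) ≤ N := by exact_mod_cast hmN.le
        simp only [hf]
        -- At a capped location the left-hand side vanishes and `M_t / N ≤ 1` is used.
        split_ifs with hcap
        · have h3 : scanProb X η t (X t ω).attacked ω = 1 := marginal_eq_one hη1 hm hmN hw hcap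
          rw [h3]
          have h4 : η / N ^ 2 * ((X t ω).plays : ℝ) ≤ η / (N * (1 - η)) := by
            calc η / N ^ 2 * ((X t ω).plays : ℝ) ≤ η / N ^ 2 * N := by gcongr
              _ = η / (N * 1) := by field_simp
              _ ≤ η / (N * (1 - η)) := by
                apply div_le_div_of_nonneg_left hη0.le (by positivity)
                gcongr
                linarith
          have h5 : 0 ≤ b * η ^ 2 / (N ^ 2 * (1 - η)) := by positivity
          linarith
        · have h3 : 0 < scanProb X η t (X t ω).attacked ω := marginal_pos hη0 hη1 hm hmN hw _
          rw [add_mul, div_mul_cancel₀ _ h3.ne', add_sub_assoc]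
          have h4 : (X t ω).plays * η ^ 2 / (N ^ 2 * (1 - η)) ≤
              b * η ^ 2 / (N ^ 2 * (1 - η)) := by gcongr
          have h5 : (X t ω).plays * η / (N : ℝ) ^ 2 = η / N ^ 2 * (X t ω).plays := by ring
          linarith
    _ = _ := by
        rw [integral_sub hint (hpl.const_mul _),
          integral_add (hα.const_mul _) (integrable_const _), integral_const_mul,
          integral_const_mul]
        simp

/-- The regret bound of Exp3.M-VP against uniformly random scanning. -/
theorem IsGame.le_integral_reward (hX : IsGame P X T a b D η π) (hD : IsDepRound D)
    (hη0 : 0 < η) (hη1 : η < 1) (ha : 1 ≤ a) (hbN : b < N)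
    (hν : ∀ t < T, ∫ ω, ((X t ω).plays : ℝ) ∂P = ν) :
    (1 - η) * (ν * T / N) - N * (1 - η) * Real.log N / η - T * b * η / N ≤
      ∫ ω, ∑ t ∈ Finset.range T, (X t ω).defenderReward ∂P := by
  have hN0 : (0 : ℝ) < N := by exact_mod_cast (by omega : 0 < N)
  have h1η : 0 < 1 - η := by linarith
  have h1 : 0 ≤ ∫ ω, (Real.log N + ∑ t ∈ Finset.range T, potentialIncrement η X t ω) ∂P :=
    integral_nonneg fun ω => hX.sum_potentialIncrement_nonneg hη0 hη1 ha hbN ω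
  have hi : ∀ t ∈ Finset.range T, Integrable (potentialIncrement η X t) P := fun t ht =>
    hX.integrable_potentialIncrement (Finset.mem_range.1 ht)
  rw [integral_add (integrable_const _) (integrable_finsetSum _ hi), integral_finsetSum _ hi] at h1
  have h2 : ∑ t ∈ Finset.range T, ∫ ω, potentialIncrement η X t ω ∂P ≤
      ∑ t ∈ Finset.range T, (η / (N * (1 - η)) * ∫ ω, (X t ω).defenderReward ∂P +
        b * η ^ 2 / (N ^ 2 * (1 - η)) - η / N ^ 2 * ν) := by
    refine Finset.sum_le_sum fun t ht => ?_
    rw [← hν t (Finset.mem_range.1 ht)]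
    exact hX.integral_potentialIncrement_le hD hη0 hη1 ha hbN (Finset.mem_range.1 ht)
  rw [Finset.sum_sub_distrib, Finset.sum_add_distrib, ← Finset.mul_sum,
    ← hX.integral_sum_round fun r => r.defenderReward] at h2
  simp only [Finset.sum_const, Finset.card_range, nsmul_eq_mul, integral_const, probReal_univ,
    smul_eq_mul, one_mul] at h1 h2
  set E := ∫ ω, ∑ t ∈ Finset.range T, (X t ω).defenderReward ∂P
  have h3 : 0 ≤ Real.log N + (η / (N * (1 - η)) * E + T * (b * η ^ 2 / (N ^ 2 * (1 - η))) -
      T * (η / N ^ 2 * ν)) := by linarith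
  have h4 := mul_nonneg (by positivity : 0 ≤ N * (1 - η) / η) h3
  have h5 : N * (1 - η) / η * (Real.log N + (η / (N * (1 - η)) * E +
      T * (b * η ^ 2 / (N ^ 2 * (1 - η))) - T * (η / N ^ 2 * ν))) =
      E - ((1 - η) * (ν * T / N) - N * (1 - η) * Real.log N / η - T * b * η / N) := by
    field_simp
    ring
  linarith

end Bounds

/-! ### The limit of long horizons -/

section Tuning

variable {N a b : ℕ}

theorem tunedEta_eq (N a b T : ℕ) : tunedEta N a b T =
    min 1 (Real.sqrt ((N : ℝ) * a * Real.log ((N : ℝ) / b) /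
      (((a : ℝ) + (Real.exp 1 - 2) * b) * b) / T)) := by
  rw [tunedEta, div_div]

theorem tunedEta_const_pos (ha : 1 ≤ a) (hab : a ≤ b) (hbN : b < N) :
    0 < (N : ℝ) * a * Real.log ((N : ℝ) / b) / (((a : ℝ) + (Real.exp 1 - 2) * b) * b) := by
  have ha0 : (0 : ℝ) < a := by exact_mod_cast ha
  have hb0 : (0 : ℝ) < b := by exact_mod_cast ha.trans hab
  have hbN' : (b : ℝ) < N := by exact_mod_cast hbN
  have hN0 : (0 : ℝ) < N := hb0.trans hbN'
  have hlog : 0 < Real.log ((N : ℝ) / b) := Real.log_pos ((one_lt_div hb0).2 hbN')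
  have he : 0 < Real.exp 1 - 2 := by linarith [Real.exp_one_gt_d9]
  positivity

/-- For all sufficiently long horizons the minimum in `tunedEta` is attained by the square root. -/
theorem eventually_tunedEta (ha : 1 ≤ a) (hab : a ≤ b) (hbN : b < N) :
    ∃ C > 0, ∀ᶠ T : ℕ in atTop, 0 < T ∧ tunedEta N a b T = Real.sqrt (C / T) ∧
      0 < tunedEta N a b T ∧ tunedEta N a b T < 1 := by
  refine ⟨_, tunedEta_const_pos ha hab hbN, ?_⟩
  have hC := tunedEta_const_pos ha hab hbN
  simp only [tunedEta_eq]
  set C := (N : ℝ) * a * Real.log ((N : ℝ) / b) / (((a : ℝ) + (Real.exp 1 - 2) * b) * b)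
  filter_upwards [eventually_gt_atTop 0, tendsto_natCast_atTop_atTop.eventually_gt_atTop C]
    with T hT hCT
  have hT0 : (0 : ℝ) < T := by exact_mod_cast hT
  have h1 : Real.sqrt (C / T) < 1 := by
    rw [Real.sqrt_lt' one_pos, one_pow, div_lt_one hT0]
    exact hCT
  rw [min_eq_right h1.le]
  exact ⟨hT, rfl, Real.sqrt_pos.2 (div_pos hC hT0), h1⟩

theorem tendsto_tunedEta (ha : 1 ≤ a) (hab : a ≤ b) (hbN : b < N) :
    Tendsto (tunedEta N a b) atTop (𝓝 0) := by
  obtain ⟨C, -, h⟩ := eventually_tunedEta ha hab hbN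
  have h1 : Tendsto (fun T : ℕ => Real.sqrt (C / T)) atTop (𝓝 0) := by
    simpa using (tendsto_const_div_atTop_nhds_zero_nat C).sqrt
  exact h1.congr' (h.mono fun T hT => hT.2.1.symm)

theorem tendsto_tunedEta_mul_inv (ha : 1 ≤ a) (hab : a ≤ b) (hbN : b < N) :
    Tendsto (fun T : ℕ => (tunedEta N a b T * T)⁻¹) atTop (𝓝 0) := by
  obtain ⟨C, hC, h⟩ := eventually_tunedEta ha hab hbN
  have h1 : Tendsto (fun T : ℕ => Real.sqrt (C * T)) atTop atTop :=
    Real.tendsto_sqrt_atTop.comp (tendsto_natCast_atTop_atTop.const_mul_atTop hC)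
  refine (h1.congr' (h.mono fun T hT => ?_)).inv_tendsto_atTop
  obtain ⟨hT, hT', -⟩ := hT
  have hT0 : (0 : ℝ) < T := by exact_mod_cast hT
  rw [hT']
  conv_rhs => rw [← Real.sqrt_sq hT0.le]
  rw [← Real.sqrt_mul (by positivity), Real.sqrt_sq hT0.le]
  congr 1
  field_simp

end Tuning

theorem mainTheorem5 {N a b : ℕ} (ha : 1 ≤ a) (hab : a ≤ b) (hbN : b < N) (ν : ℝ)
    (D : (Fin N → ℝ) → PMF (Finset (Fin N))) (hD : IsDepRound D)
    (π : ℕ → AttackerPolicy N) (hπ : NoRegret.{u} π)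
    (Ω : ℕ → Type u) [∀ T, MeasurableSpace (Ω T)]
    (P : (T : ℕ) → Measure (Ω T)) [∀ T, IsProbabilityMeasure (P T)]
    (X : (T : ℕ) → ℕ → Ω T → Round N)
    (hX : ∀ T, IsGame (P T) (X T) T a b D (tunedEta N a b T) (π T))
    (hM : ∀ T, IsWideSenseStationary (P T) (Set.Iio T)
      (fun t ω => ((X T t ω).plays : ℝ)) ν) :
    liminf (fun T : ℕ =>
      ∫ ω, 1 / (T : ℝ) * ∑ t ∈ Finset.range T, (X T t ω).defenderReward ∂(P T)) atTop
      = ν / N := by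
  obtain ⟨R, hR0, hR⟩ := hπ
  have hN0 : (N : ℝ) ≠ 0 := by exact_mod_cast (by omega : N ≠ 0)
  obtain ⟨_, _, hev⟩ := eventually_tunedEta ha hab hbN
  have hη := tendsto_tunedEta ha hab hbN
  have hηT := tendsto_tunedEta_mul_inv ha hab hbN
  have hlow : Tendsto (fun T : ℕ => (1 - tunedEta N a b T) * (ν / N) -
      N * (1 - tunedEta N a b T) * Real.log N * (tunedEta N a b T * T)⁻¹ -
      b * tunedEta N a b T / N) atTop (𝓝 (ν / N)) := by
    have h1 := ((hη.const_sub 1).mul_const (ν / N)).sub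
      ((((hη.const_sub 1).const_mul (N : ℝ)).mul_const (Real.log N)).mul hηT)
    have h2 := h1.sub ((hη.const_mul (b : ℝ)).div_const (N : ℝ))
    simpa using h2
  have hup : Tendsto (fun T : ℕ => ν / N + R T / T) atTop (𝓝 (ν / N)) := by
    simpa using hR0.const_add (ν / N)
  refine (tendsto_of_tendsto_of_tendsto_of_le_of_le' hlow hup ?_ ?_).liminf_eq
  · filter_upwards [hev] with T hT'
    obtain ⟨hT, -, hη0, hη1⟩ := hT'
    have hT0 : (0 : ℝ) < T := by exact_mod_cast hT
    have h := (hX T).le_integral_reward hD hη0 hη1 ha hbN fun t ht => (hM T).mean t ht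
    rw [integral_const_mul, one_div_mul_eq_div, le_div_iff₀ hT0]
    refine le_trans (le_of_eq ?_) h
    have := hη0.ne'
    field_simp
  · filter_upwards [hev] with T hT'
    obtain ⟨hT, -, hη0, hη1⟩ := hT'
    have hT0 : (0 : ℝ) < T := by exact_mod_cast hT
    have h := (hX T).integral_reward_le hD hη0 hη1 ha hbN (fun t ht => (hM T).mean t ht)
      (hR T (Ω T) (P T) (fun t ω => (X T t ω).attacked) (fun t ω => (X T t ω).scanned)
        (fun t s _ => (hX T).measurableSet_round t fun r => r.attacked ∈ s)
        (fun t s _ => (hX T).measurableSet_round t fun r => r.scanned ∈ s)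
        (hX T).followsPolicy)
    rw [integral_const_mul, one_div_mul_eq_div, div_le_iff₀ hT0]
    refine h.trans (le_of_eq ?_)
    field_simp
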